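/- Let $C_8$ be the linearly ordered Heyting algebra with universe $0<a_1<a_2<\dots<a_6<1$, and let $\boldsymbol A$ be the algebra obtained by endowing $C_8$ (with operations $\wedge,\vee,\to,0,1$) with a constant for $a_5$, binary operations $+,\ast$ and unary operations $\Box,\Diamond$ given, for all $a,b\in A$, by $$a+b=\begin{cases}a_6&\text{if }a=0,\ b\in\{a_6,1\};\\ a_5&\text{if }a=0,\ b=a_3;\\ a_2&\text{if }(a=0,\ b\notin\{a_3,a_6,1\})\text{ or }(a\neq0,\ b\neq a_1);\\ a_1&\text{if }a\neq 0,\ b=a_1;\end{cases}\qquad a\ast b=\begin{cases}1&\text{if }a=a_4,\ b=a_6;\\0&\text{otherwise};\end{cases}$$ $$\Box a=\begin{cases}1&\text{if }a=a_5;\\0&\text{otherwise};\end{cases}\qquad \Diamond a=\begin{cases}1&\text{if }a\in\{0,a_6,1\};\\a_1&\text{if }a\in\{a_1,a_2\};\\a_3&\text{if }a\in\{a_3,a_5\};\\a_5&\text{if }a=a_4.\end{cases}$$ Let $\mathsf K=\mathbb V(\boldsymbol A)$ be the variety generated by $\boldsymbol A$. Terminology. A primitive positive (pp) formula is a finite conjunction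 of equations preceded by existential quantifiers. An $n$-ary implicit operation of $\mathsf K$ ($n\ge1$) is a family $f=\langle f^{\boldsymbol B}:\boldsymbol B\in\mathsf K\rangle$ of $n$-ary partial functions $f^{\boldsymbol B}$ on $B$ that is preserved by all homomorphisms between members of $\mathsf K$ and is defined by some first-order formula $\varphi(x_1,\dots,x_n,y)$, i.e. for every $\boldsymbol B\in\mathsf K$ the graph of $f^{\boldsymbol B}$ is $\{\langle b_1,\dots,b_n,c\rangle:\boldsymbol B\vDash\varphi(b_1,\dots,b_n,c)\}$. It is extendable if every $\boldsymbol B\in\mathsf K$ is a subalgebra of some $\boldsymbol D\in\mathsf K$ with $f^{\boldsymbol D}$ total. For a set $\mathcal F$ of extendable implicit operations of $\mathsf K$ defined by pp formulas, let $\mathscr L_{\mathcal F}$ be the language of $\mathsf K$ expanded with a new $n$-ary function symbol $g_f$ for each $n$-ary $f\in\mathcal F$. For $\boldsymbol D\in\mathsf K$ such that $f^{\boldsymbol D}$ is total for all $f\in\mathcal F$, let $\boldsymbol D[\mathscr L_{\mathcal F}]$ be the expansion of $\boldsymbol D$ in which $g_f$ is interpreted as $f^{\boldsymbol D}$, and let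 $\mathsf K[\mathscr L_{\mathcal F}]$ be the class of all algebras $\boldsymbol D[\mathscr L_{\mathcal F}]$. The pp expansion of $\mathsf K$ induced by $\mathcal F$ is the class $\mathbb S(\mathsf K[\mathscr L_{\mathcal F}])$ of (isomorphic copies of) subalgebras of members of $\mathsf K[\mathscr L_{\mathcal F}]$. For a class $\mathsf N$ and an algebra $\boldsymbol B$ in its language, $\mathsf{Con}_{\mathsf N}(\boldsymbol B)$ is the set of congruences $\theta$ of $\boldsymbol B$ with $\boldsymbol B/\theta\in\mathsf N$. A pp expansion $\mathsf M$ of $\mathsf K$ is congruence preserving if $\mathsf{Con}_{\mathsf M}(\boldsymbol B)=\mathsf{Con}_{\mathsf K}(\boldsymbol B{\upharpoonright})$ for every $\boldsymbol B\in\mathsf M$, where $\boldsymbol B{\upharpoonright}$ is the reduct of $\boldsymbol B$ to the language of $\mathsf K$. A variety is a class of similar algebras closed under homomorphic images, subalgebras and direct products; a quasivariety is one closed under isomorphic copies, subalgebras, direct products and ultraproducts; a quasivariety is proper if it is not a variety. **Theorem.** The pp formula $\varphi(x,y)=\exists z\,(x+y\approx\Diamond z)$ defines an extendable implicit operation $f$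 of $\mathbb V(\boldsymbol A)$. The pp expansion $\mathsf M$ of $\mathbb V(\boldsymbol A)$ induced by $\{f\}$ is a proper quasivariety (it is not closed under homomorphic images), and it is not congruence preserving. In particular, $\mathbb V(\boldsymbol A)$ has a pp expansion that is a proper quasivariety and is not congruence preserving. -/

import Mathlib

universe u

namespace PPExpansions

open FirstOrder FirstOrder.Language CategoryTheory

universe v w

/-! ## Classes of algebras

Algebras are structures of a first order language without relation symbols. All the languages to
which the notions below are applied contain constants, so that algebras are nonempty. -/

/-- Algebras of the language `L` with carrier in `Type u`. -/
abbrev Alg (L : FirstOrder.Language.{v, w}) := Bundled.{u} L.Structure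

section Operators

variable {L : FirstOrder.Language.{v, w}}

/-- The direct product of a family of algebras. -/
def piAlg {I : Type u} (A : I → Alg.{u} L) : Alg.{u} L :=
  ⟨∀ i, A i,
    { funMap := fun f x i => Structure.funMap f (fun j => x j i)
      RelMap := fun r x => ∀ i, Structure.RelMap r (fun j => x j i) }⟩

/-- The ultraproduct of a family of algebras. -/
def ultraAlg {I : Type u} (U : Ultrafilter I) (A : I → Alg.{u} L) : Alg.{u} L :=
  ⟨(U : Filter I).Product (fun i => A i), inferInstance⟩

def ClosedUnderI (K : Set (Alg.{u} L)) : Prop :=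
  ∀ A ∈ K, ∀ B : Alg.{u} L, Nonempty (A ≃[L] B) → B ∈ K

/-- Closure under homomorphic images. -/
def ClosedUnderH (K : Set (Alg.{u} L)) : Prop :=
  ∀ A ∈ K, ∀ (B : Alg.{u} L) (h : A →[L] B), Function.Surjective h → B ∈ K

/-- Closure under (isomorphic copies of) subalgebras. -/
def ClosedUnderS (K : Set (Alg.{u} L)) : Prop :=
  ∀ A ∈ K, ∀ B : Alg.{u} L, Nonempty (B ↪[L] A) → B ∈ K

/-- Closure under direct products (the index set may be empty). -/
def ClosedUnderP (K : Set (Alg.{u} L)) : Prop :=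
  ∀ (I : Type u) (A : I → Alg.{u} L), (∀ i, A i ∈ K) → piAlg A ∈ K

def ClosedUnderPu (K : Set (Alg.{u} L)) : Prop :=
  ∀ (I : Type u) (U : Ultrafilter I) (A : I → Alg.{u} L), (∀ i, A i ∈ K) → ultraAlg U A ∈ K

def IsVariety (K : Set (Alg.{u} L)) : Prop :=
  ClosedUnderH K ∧ ClosedUnderS K ∧ ClosedUnderP K

def IsQuasivariety (K : Set (Alg.{u} L)) : Prop :=
  ClosedUnderI K ∧ ClosedUnderS K ∧ ClosedUnderP K ∧ ClosedUnderPu K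

def IsProperQuasivariety (K : Set (Alg.{u} L)) : Prop :=
  IsQuasivariety K ∧ ¬ IsVariety K

/-- The variety `𝕍(A)` generated by an algebra: the least variety containing it. -/
def varietyOf (A : Alg.{u} L) : Set (Alg.{u} L) :=
  {B | ∀ K : Set (Alg.{u} L), IsVariety K → A ∈ K → B ∈ K}

/-- The class `𝕊(K)` of (isomorphic copies of) subalgebras of members of `K`. -/
def subalgebrasOf (K : Set (Alg.{u} L)) : Set (Alg.{u} L) :=
  {B | ∃ A ∈ K, Nonempty (B ↪[L] A)}

/-! ## Congruences -/

def IsCongruence (A : Alg.{u} L) (θ : Setoid A) : Prop :=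
  ∀ (n : ℕ) (f : L.Functions n) (x y : Fin n → A),
    (∀ i, θ (x i) (y i)) → θ (Structure.funMap f x) (Structure.funMap f y)

/-- The quotient algebra `A / θ`. The operations are computed on representatives; when `θ` is a
congruence their choice is immaterial, see `quotientAlg_funMap_mk`. -/
noncomputable def quotientAlg (A : Alg.{u} L) (θ : Setoid A) : Alg.{u} L :=
  ⟨Quotient θ,
    { funMap := fun f x => Quotient.mk θ (Structure.funMap f (fun i => (x i).out))
      RelMap := fun r x => ∃ y, Structure.RelMap r y ∧ ∀ i, Quotient.mk θ (y i) = x i }⟩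

theorem quotientAlg_funMap_mk (A : Alg.{u} L) (θ : Setoid A) (hθ : IsCongruence A θ) {n : ℕ}
    (f : L.Functions n) (x : Fin n → A) :
    (Structure.funMap f (fun i => (Quotient.mk θ (x i) : quotientAlg A θ)) : quotientAlg A θ) =
      (Quotient.mk θ (Structure.funMap f x) : Quotient θ) :=
  Quotient.sound (hθ n f _ _ fun i => Quotient.mk_out (s := θ) (x i))

/-- The set `Con_K(A)` of `K`-congruences of `A`: the congruences `θ` such that `A / θ ∈ K`. -/
def relCon (K : Set (Alg.{u} L)) (A : Alg.{u} L) : Set (Setoid A) :=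
  {θ | IsCongruence A θ ∧ quotientAlg A θ ∈ K}

/-! ## Primitive positive formulas -/

/-- Finite nonempty conjunctions of equations. -/
inductive IsEqConj {α : Type} {n : ℕ} : L.BoundedFormula α n → Prop
  | equal (s t : L.Term (α ⊕ Fin n)) : IsEqConj (s =' t)
  | inf {φ ψ : L.BoundedFormula α n} : IsEqConj φ → IsEqConj ψ → IsEqConj (φ ⊓ ψ)

/-- Primitive positive formulas: existentially quantified conjunctions of equations. -/
inductive IsPP {α : Type} : {n : ℕ} → L.BoundedFormula α n → Prop
  | conj {n : ℕ} {φ : L.BoundedFormula α n} : IsEqConj φ → IsPP φ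
  | ex {n : ℕ} {φ : L.BoundedFormula α (n + 1)} : IsPP φ → IsPP φ.ex

/-! ## Implicit operations -/

/-- `A ⊨ φ(a₁, …, aₙ, b)`. In `φ` the variable `Sum.inl i` plays the role of `xᵢ` and the variable
`Sum.inr ()` that of `y`. -/
def Sat (A : Alg.{u} L) {n : ℕ} (φ : L.Formula (Fin n ⊕ Unit)) (a : Fin n → A) (b : A) : Prop :=
  φ.Realize (Sum.elim a fun _ => b)

/-- `φ(x₁, …, xₙ, y)`, with `n ≥ 1`, is functional in `K`. -/
def IsFunctional (K : Set (Alg.{u} L)) {n : ℕ} (φ : L.Formula (Fin n ⊕ Unit)) : Prop :=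
  1 ≤ n ∧ ∀ A ∈ K, ∀ (a : Fin n → A) (b c : A), Sat A φ a b → Sat A φ a c → b = c

/-- An `n`-ary partial function on the class `K`: an `n`-ary partial function on each member. -/
abbrev PartialFunctionOn (K : Set (Alg.{u} L)) (n : ℕ) :=
  ∀ A : K, (Fin n → A.1) →. A.1

variable {K : Set (Alg.{u} L)} {n : ℕ}

/-- `f` is defined by `φ`: the formula is functional in `K` and its graph is that of `f`. -/
def DefinedBy (f : PartialFunctionOn K n) (φ : L.Formula (Fin n ⊕ Unit)) : Prop :=
  IsFunctional K φ ∧ ∀ (A : K) (a : Fin n → A.1) (b : A.1), b ∈ f A a ↔ Sat A.1 φ a b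

/-- `f` is preserved by all homomorphisms between members of `K`. -/
def IsOperation (f : PartialFunctionOn K n) : Prop :=
  ∀ (A B : K) (h : A.1 →[L] B.1) (a : Fin n → A.1) (b : A.1),
    b ∈ f A a → h b ∈ f B (fun i => h (a i))

def IsImplicitOperation (f : PartialFunctionOn K n) : Prop :=
  (∃ φ : L.Formula (Fin n ⊕ Unit), DefinedBy f φ) ∧ IsOperation f

def TotalOn (f : PartialFunctionOn K n) (A : K) : Prop :=
  ∀ a : Fin n → A.1, (f A a).Dom

/-- Every member of `K` extends to a member of `K` on which `f` is total. -/
def IsExtendable (f : PartialFunctionOn K n) : Prop :=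
  ∀ A : K, ∃ B : K, Nonempty (A.1 ↪[L] B.1) ∧ TotalOn f B

variable (K n) in
/-- `ext_pp(K)`: the extendable implicit operations defined by primitive positive formulas. -/
def extPP : Set (PartialFunctionOn K n) :=
  {f | IsImplicitOperation f ∧ IsExtendable f ∧
    ∃ φ : L.Formula (Fin n ⊕ Unit), IsPP φ ∧ DefinedBy f φ}

end Operators

/-! ## pp expansions -/

/-- A family of members of `ext_pp(K)`. -/
structure ExtPPFamily {L : FirstOrder.Language.{v, w}} (K : Set (Alg.{u} L)) where
  ι : Type
  arity : ι → ℕ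
  op : ∀ i, PartialFunctionOn K (arity i)
  mem : ∀ i, op i ∈ extPP K (arity i)

namespace ExtPPFamily

variable {L : FirstOrder.Language.{v, w}} {K : Set (Alg.{u} L)}

/-- The family consisting of one operation. -/
def single {n : ℕ} (f : PartialFunctionOn K n) (hf : f ∈ extPP K n) : ExtPPFamily K :=
  ⟨Unit, fun _ => n, fun _ => f, fun _ => hf⟩

variable (F : ExtPPFamily K)

/-- The language consisting of a new `n`-ary function symbol for each `n`-ary member of `F`. -/
def newSymbols : FirstOrder.Language.{0, 0} :=
  ⟨fun n => {i : F.ι // F.arity i = n}, fun _ => Empty⟩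

/-- The expanded language `L_F`. -/
abbrev expandedLanguage : FirstOrder.Language := L.sum F.newSymbols

/-- The new function symbol associated with the `i`-th member of `F`. -/
def symbol (i : F.ι) : F.expandedLanguage.Functions (F.arity i) :=
  Sum.inr (⟨i, rfl⟩ : {j : F.ι // F.arity j = F.arity i})

/-- The reduct of an algebra in the expanded language to the language `L`. -/
def reduct (B : Alg.{u} F.expandedLanguage) : Alg.{u} L :=
  ⟨B, (LHom.sumInl : L →ᴸ F.expandedLanguage).reduct B⟩

/-- The class `K[L_F]` of the algebras `A[L_F]`, where `A` is a member of `K` on which every member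
of `F` is total, and each new symbol is interpreted in `A[L_F]` as the corresponding operation. -/
def expandedClass : Set (Alg.{u} F.expandedLanguage) :=
  {B | ∃ hB : F.reduct B ∈ K, ∀ (i : F.ι) (a : Fin (F.arity i) → B),
    (Structure.funMap (F.symbol i) a : B) ∈ F.op i ⟨F.reduct B, hB⟩ a}

/-- The pp expansion `𝕊(K[L_F])` of `K` induced by `F`. -/
def ppExpansion : Set (Alg.{u} F.expandedLanguage) :=
  subalgebrasOf F.expandedClass

/-- The pp expansion `M` of `K` induced by `F` is congruence preserving: each member of `M` has the
same `M`-congruences as its reduct has `K`-congruences. -/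
def CongruencePreserving : Prop :=
  ∀ B ∈ F.ppExpansion, relCon F.ppExpansion B = relCon K (F.reduct B)

end ExtPPFamily

/-! ## The algebra -/

/-- Function symbols: those of Heyting algebras, a constant `a5`, and symbols for `+`, `∗`, `□`
and `◇`. -/
inductive Symb : ℕ → Type
  | bot : Symb 0
  | top : Symb 0
  | a5 : Symb 0
  | box : Symb 1
  | dia : Symb 1
  | inf : Symb 2
  | sup : Symb 2
  | imp : Symb 2
  | add : Symb 2
  | star : Symb 2

def lang : FirstOrder.Language.{0, 0} := ⟨Symb, fun _ => Empty⟩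

/-- The chain `0 < a₁ < ⋯ < a₆ < 1`, where `aᵢ` is the number `i` and `1` is the number `7`. -/
abbrev Chain : Type := Fin 8

def addOp (a b : Chain) : Chain :=
  if a = 0 then
    if b = 6 ∨ b = 7 then 6 else if b = 3 then 5 else 2
  else
    if b = 1 then 1 else 2

def starOp (a b : Chain) : Chain := if a = 4 ∧ b = 6 then 7 else 0

def boxOp (a : Chain) : Chain := if a = 5 then 7 else 0

def diaOp : Chain → Chain := ![7, 1, 1, 3, 5, 3, 7, 7]

instance chainStructure : lang.Structure Chain where
  funMap {n} (f : Symb n) := match n, f with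
    | _, .bot => fun _ => 0
    | _, .top => fun _ => 7
    | _, .a5 => fun _ => 5
    | _, .box => fun x => boxOp (x 0)
    | _, .dia => fun x => diaOp (x 0)
    | _, .inf => fun x => min (x 0) (x 1)
    | _, .sup => fun x => max (x 0) (x 1)
    | _, .imp => fun x => if x 0 ≤ x 1 then 7 else x 1
    | _, .add => fun x => addOp (x 0) (x 1)
    | _, .star => fun x => starOp (x 0) (x 1)
  RelMap r := r.elim

/-- The eight-element algebra `A`, as an algebra with carrier in `Type u`. -/
def A8 : Alg.{u} lang := Equiv.ulift.{u}.symm.bundledInduced (M := Chain) lang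

/-- The formula `∃ z (x + y ≈ ◇ z)`. -/
def phi : lang.Formula (Fin 1 ⊕ Unit) :=
  BoundedFormula.ex (n := 0)
    (Term.bdEqual
      (Term.func (L := lang) (l := 2) Symb.add
        ![Term.var (Sum.inl (Sum.inl 0)), Term.var (Sum.inl (Sum.inr ()))])
      (Term.func (L := lang) (l := 1) Symb.dia ![Term.var (Sum.inr 0)]))

end PPExpansions

/-! On `Chain` the formula defines a total function. The values of ◇ are a₁, a₃, a₅, 1, and a sum 0
+ y is one of a₂, a₅, a₆, so it is a value of ◇ only for y = a₃, with witness a₅ = ◇a₄. For x ≠ 0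
the only solution is y = a₁. Removing a₄ leaves a subalgebra B closed under this function, although
the witness at 0 is lost. In B the pair {a₆, 1} can be collapsed, and then 0 + 1 = a₆ becomes equal
to 1 = ◇0: in the quotient B/θ the formula forces the value 1 at 0.

Thus B, with 0 ↦ a₃, belongs to the pp expansion, while B/θ with the inherited operation does not:
in an extension both a₃ and 1 would be values at 0. Yet θ is a congruence of the expanded B, and the
reduct of B/θ stays in the variety. This refutes closure under homomorphic images and congruence
preservation together (`quotient_notMem`).

That the formula is functional and extendable rests on `exists_separating_of_mem`: homomorphisms
into `Chain` and B/θ separate the points of each member of the variety. This is proved by a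
Jónsson-style argument, in which ∗ and □ exclude all other proper quotients of subalgebras of
`Chain`. Functionality is then read off the two finite algebras, and each member embeds into a
product of copies of them, where the operation is total.

The quasivariety axioms hold because pp formulas pass to homomorphic images and products. -/

namespace PPExpansions

open FirstOrder FirstOrder.Language CategoryTheory

universe v w

/-! ### Homomorphisms, basic operations and the graph defined by the formula -/

section Terms

variable {M N : Type*} [lang.Structure M] [lang.Structure N]

/-- The value of a constant symbol. -/
def op0 (s : Symb 0) : M := Structure.funMap (L := lang) (n := 0) s ![]

/-- The unary operation denoted by a symbol. -/
def op1 (s : Symb 1) (x : M) : M := Structure.funMap (L := lang) (n := 1) s ![x]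

/-- The binary operation denoted by a symbol. -/
def op2 (s : Symb 2) (x y : M) : M := Structure.funMap (L := lang) (n := 2) s ![x, y]

theorem map_op0 (h : M →[lang] N) (s : Symb 0) : h (op0 s) = op0 s :=
  (h.map_fun' (n := 0) s ![]).trans
    (congrArg (Structure.funMap (L := lang) (n := 0) s) (Subsingleton.elim _ _))

theorem map_op1 (h : M →[lang] N) (s : Symb 1) (x : M) : h (op1 s x) = op1 s (h x) :=
  (h.map_fun' (n := 1) s ![x]).trans
    (congrArg (Structure.funMap (L := lang) (n := 1) s) (by funext i; fin_cases i; rfl))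

theorem map_op2 (h : M →[lang] N) (s : Symb 2) (x y : M) :
    h (op2 s x y) = op2 s (h x) (h y) :=
  (h.map_fun' (n := 2) s ![x, y]).trans
    (congrArg (Structure.funMap (L := lang) (n := 2) s) (by funext i; fin_cases i <;> rfl))

/-- The Heyting equivalence `x ↔ y`. -/
def equivOp (x y : M) : M := op2 .inf (op2 .imp x y) (op2 .imp y x)

/-- The graph of the operation defined by `phi`. -/
def Graph (x y : M) : Prop := ∃ z : M, op2 .add x y = op1 .dia z

theorem Graph.map {x y : M} (hxy : Graph x y) (h : M →[lang] N) : Graph (h x) (h y) := by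
  obtain ⟨z, hz⟩ := hxy
  exact ⟨h z, by rw [← map_op2, hz, map_op1]⟩

end Terms

theorem sat_phi_iff (A : Alg.{u} lang) (a : Fin 1 → A) (b : A) :
    Sat A phi a b ↔ Graph (a 0) b := by
  unfold Sat phi Formula.Realize Graph op1 op2
  rw [BoundedFormula.realize_ex]
  refine exists_congr fun z => ?_
  rw [BoundedFormula.realize_bdEqual]
  have h1 : (fun i : Fin 2 => Term.realize (L := lang)
      (Sum.elim (Sum.elim a fun _ => b) (Fin.snoc default z : Fin (0 + 1) → A))
      ((![Term.var (Sum.inl (Sum.inl 0)), Term.var (Sum.inl (Sum.inr ()))] :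
        Fin 2 → lang.Term ((Fin 1 ⊕ Unit) ⊕ Fin (0 + 1))) i)) = ![a 0, b] := by
    funext i
    fin_cases i <;> rfl
  have h2 : (fun i : Fin 1 => Term.realize (L := lang)
      (Sum.elim (Sum.elim a fun _ => b) (Fin.snoc default z : Fin (0 + 1) → A))
      ((![Term.var (Sum.inr 0)] :
        Fin 1 → lang.Term ((Fin 1 ⊕ Unit) ⊕ Fin (0 + 1))) i)) = ![z] := by
    funext i
    fin_cases i
    rfl
  exact Eq.congr (congrArg _ h1) (congrArg _ h2)

/-! ## Chains -/

theorem chain_bot : (op0 .bot : Chain) = 0 := rfl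
theorem chain_a5 : (op0 .a5 : Chain) = 5 := rfl
theorem chain_box (x : Chain) : op1 .box x = boxOp x := rfl
theorem chain_inf (x y : Chain) : op2 .inf x y = min x y := rfl
theorem chain_sup (x y : Chain) : op2 .sup x y = max x y := rfl
theorem chain_imp (x y : Chain) : op2 .imp x y = if x ≤ y then 7 else y := rfl
theorem chain_star (x y : Chain) : op2 .star x y = starOp x y := rfl

/-- The inclusion of the subalgebra with universe `Chain \ {a₄}`. -/
def subIncl : Fin 7 → Chain := ![0, 1, 2, 3, 5, 6, 7]

/-- A retraction of `subIncl`. -/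
def subRetr : Chain → Fin 7 := ![0, 1, 2, 3, 3, 4, 5, 6]

/-- The quotient map from `Chain \ {a₄}` identifying `a₆` and `1`; its value at `a₄` is
immaterial. -/
def quotMap : Chain → Fin 6 := ![0, 1, 2, 3, 3, 4, 5, 5]

/-- A section of `quotMap`. -/
def quotSec : Fin 6 → Chain := ![0, 1, 2, 3, 5, 7]

/-- The subalgebra of `Chain` with universe `Chain \ {a₄}`. -/
instance subStructure : lang.Structure (Fin 7) where
  funMap f x := subRetr (Structure.funMap f fun i => subIncl (x i))
  RelMap r := r.elim

/-- The quotient of `Chain \ {a₄}` by the congruence identifying `a₆` and `1`. -/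
instance quotStructure : lang.Structure (Fin 6) where
  funMap f x := quotMap (Structure.funMap f fun i => quotSec (x i))
  RelMap r := r.elim

/-- No constant and no value of +, ∗, □, ◇ is a₄, and the lattice operations and → only return an
argument or 1. Hence a₄ can be dropped from the universe. -/
theorem funMap_ne_four {n : ℕ} (f : lang.Functions n) (x : Fin n → Chain) (hx : ∀ i, x i ≠ 4) :
    Structure.funMap f x ≠ 4 := by
  change Symb n at f
  cases f
  case bot => exact show (0 : Chain) ≠ 4 by decide
  case top => exact show (7 : Chain) ≠ 4 by decide
  case a5 => exact show (5 : Chain) ≠ 4 by decide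
  case box =>
    change boxOp (x 0) ≠ 4
    generalize x 0 = p
    decide +revert
  case dia =>
    change diaOp (x 0) ≠ 4
    generalize x 0 = p
    decide +revert
  case inf =>
    have h0 := hx 0
    have h1 := hx 1
    change min (x 0) (x 1) ≠ 4
    generalize x 0 = p at *
    generalize x 1 = q at *
    clear hx
    decide +revert
  case sup =>
    have h0 := hx 0
    have h1 := hx 1
    change max (x 0) (x 1) ≠ 4
    generalize x 0 = p at *
    generalize x 1 = q at *
    clear hx
    decide +revert
  case imp =>
    have h1 := hx 1
    change (if x 0 ≤ x 1 then 7 else x 1) ≠ 4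
    split_ifs
    · decide
    · exact h1
  case add =>
    change addOp (x 0) (x 1) ≠ 4
    generalize x 0 = p
    generalize x 1 = q
    decide +revert
  case star =>
    change starOp (x 0) (x 1) ≠ 4
    generalize x 0 = p
    generalize x 1 = q
    decide +revert

theorem subIncl_subRetr (p : Chain) (hp : p ≠ 4) : subIncl (subRetr p) = p := by
  decide +revert

theorem subRetr_subIncl (p : Fin 7) : subRetr (subIncl p) = p := by
  decide +revert

theorem subIncl_ne_four (p : Fin 7) : subIncl p ≠ 4 := by
  decide +revert

/-- `quotMap` is compatible with the operations on `Chain \ {a₄}`. -/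
theorem quotMap_funMap {n : ℕ} (f : lang.Functions n) (x : Fin n → Chain) (hx : ∀ i, x i ≠ 4) :
    quotMap (Structure.funMap f x) = Structure.funMap f fun i => quotMap (x i) := by
  change Symb n at f
  change _ = quotMap (Structure.funMap (L := lang) f fun i => quotSec (quotMap (x i)))
  cases f
  case bot => rfl
  case top => rfl
  case a5 => rfl
  case box =>
    change quotMap (boxOp (x 0)) = quotMap (boxOp (quotSec (quotMap (x 0))))
    have h0 := hx 0
    generalize x 0 = p at *
    clear hx
    decide +revert
  case dia =>
    change quotMap (diaOp (x 0)) = quotMap (diaOp (quotSec (quotMap (x 0))))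
    have h0 := hx 0
    generalize x 0 = p at *
    clear hx
    decide +revert
  case inf =>
    change quotMap (min (x 0) (x 1)) =
      quotMap (min (quotSec (quotMap (x 0))) (quotSec (quotMap (x 1))))
    have h0 := hx 0
    have h1 := hx 1
    generalize x 0 = p at *
    generalize x 1 = q at *
    clear hx
    decide +revert
  case sup =>
    change quotMap (max (x 0) (x 1)) =
      quotMap (max (quotSec (quotMap (x 0))) (quotSec (quotMap (x 1))))
    have h0 := hx 0
    have h1 := hx 1
    generalize x 0 = p at *
    generalize x 1 = q at *
    clear hx
    decide +revert
  case imp =>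
    change quotMap (if x 0 ≤ x 1 then 7 else x 1) =
      quotMap (if quotSec (quotMap (x 0)) ≤ quotSec (quotMap (x 1)) then 7
        else quotSec (quotMap (x 1)))
    have h0 := hx 0
    have h1 := hx 1
    generalize x 0 = p at *
    generalize x 1 = q at *
    clear hx
    decide +revert
  case add =>
    change quotMap (addOp (x 0) (x 1)) =
      quotMap (addOp (quotSec (quotMap (x 0))) (quotSec (quotMap (x 1))))
    have h0 := hx 0
    have h1 := hx 1
    generalize x 0 = p at *
    generalize x 1 = q at *
    clear hx
    decide +revert
  -- Only ∗ could obstruct the identification of a₆ with 1, and only with a₄ as left argument; that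
  -- element is excluded here.
  case star =>
    change quotMap (starOp (x 0) (x 1)) =
      quotMap (starOp (quotSec (quotMap (x 0))) (quotSec (quotMap (x 1))))
    have h0 := hx 0
    have h1 := hx 1
    generalize x 0 = p at *
    generalize x 1 = q at *
    clear hx
    decide +revert

/-- The inclusion of `Chain \ {a₄}` as an embedding. -/
def subEmb : Fin 7 ↪[lang] Chain where
  toFun := subIncl
  inj' := Function.LeftInverse.injective subRetr_subIncl
  map_fun' f x := subIncl_subRetr _ (funMap_ne_four f _ fun i => subIncl_ne_four (x i))
  map_rel' r := r.elim

/-- The quotient map as a homomorphism. -/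
def quotHom : Fin 7 →[lang] Fin 6 where
  toFun x := quotMap (subIncl x)
  map_fun' f x := by
    rw [show subIncl (Structure.funMap f x) = Structure.funMap f fun i => subIncl (x i) from
      subEmb.map_fun f x]
    exact quotMap_funMap f _ fun i => subIncl_ne_four (x i)
  map_rel' r := r.elim

theorem quotHom_surjective : Function.Surjective quotHom := by
  change ∀ y : Fin 6, ∃ x : Fin 7, quotMap (subIncl x) = y
  decide

/-- The operation defined by `phi` on `Chain`. -/
def chainFun (x : Chain) : Chain := if x = 0 then 3 else 1

/-- The solution at x = 0 comes from 0 + a₃ = a₅ = ◇a₄, the others from x + a₁ = a₁ = ◇a₁. -/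
theorem graph_chain (x y : Chain) : Graph x y ↔ y = chainFun x := by
  change (∃ z : Chain, addOp x y = diaOp z) ↔ _
  unfold chainFun
  decide +revert

/-- The operation defined by `phi` on the quotient. -/
def quotFun (x : Fin 6) : Fin 6 := if x = 0 then 5 else 1

/-- Without a₄, the element a₅ is no longer a value of ◇; instead 0 + 1 = a₆ is identified with 1 =
◇0. The numeral 5 is the class {a₆, 1}. -/
theorem graph_quot (x y : Fin 6) : Graph x y ↔ y = quotFun x := by
  change (∃ z : Fin 6, quotMap (addOp (quotSec x) (quotSec y)) = quotMap (diaOp (quotSec z))) ↔ _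
  unfold quotFun
  decide +revert

/-! ## Homomorphisms into the chain and its quotient -/

instance isEmpty_lang_relations (n : ℕ) : IsEmpty (lang.Relations n) :=
  inferInstanceAs (IsEmpty Empty)

theorem map_equivOp {M N : Type*} [lang.Structure M] [lang.Structure N] (h : M →[lang] N)
    (x y : M) : h (equivOp x y) = equivOp (h x) (h y) := by
  simp only [equivOp, map_op2]

theorem chain_equivOp (x y : Chain) : equivOp x y = if x = y then 7 else min x y := by
  simp only [equivOp, chain_inf, chain_imp]
  decide +revert

/-- A homomorphism factors through a surjective one with a smaller kernel. -/
theorem exists_factor {L : FirstOrder.Language.{v, w}} [∀ n, IsEmpty (L.Relations n)]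
    {C E D : Type*} [L.Structure C] [L.Structure E] [L.Structure D] (h : C →[L] E)
    (hs : Function.Surjective h) (k : C →[L] D) (hk : ∀ x y, h x = h y → k x = k y) :
    ∃ g : E →[L] D, ∀ x, g (h x) = k x := by
  have key : ∀ x, k (Function.surjInv hs (h x)) = k x := fun x =>
    hk _ _ (Function.surjInv_eq hs (h x))
  refine ⟨⟨fun e => k (Function.surjInv hs e), fun f x => ?_, fun r => isEmptyElim r⟩, key⟩
  have hx : x = fun i => h (Function.surjInv hs (x i)) :=
    funext fun i => (Function.surjInv_eq hs (x i)).symm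
  have hf : Structure.funMap f x = h (Structure.funMap f fun i => Function.surjInv hs (x i)) := by
    rw [h.map_fun]
    exact congrArg _ hx
  rw [hf, key, k.map_fun]
  rfl

/-- The points of `C` are separated by homomorphisms into `Chain`. -/
def ChainSeparated (C : Type*) [lang.Structure C] : Prop :=
  ∀ x y : C, (∀ φ : C →[lang] Chain, φ x = φ y) → x = y

/-- The pointwise limit of homomorphisms into the chain along an ultrafilter. -/
theorem exists_ultralimit {C : Type*} [lang.Structure C] (U : Ultrafilter (C →[lang] Chain)) :
    ∃ v : C →[lang] Chain, ∀ x, ∀ᶠ φ in (U : Filter (C →[lang] Chain)), φ x = v x := by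
  have H : ∀ x : C, ∃ p : Chain, ∀ᶠ φ in (U : Filter (C →[lang] Chain)), φ x = p := by
    intro x
    obtain ⟨p, hp⟩ := (U.map fun φ => φ x).eq_pure_of_finite
    refine ⟨p, ?_⟩
    have : ({p} : Set Chain) ∈ U.map fun φ => φ x := by
      rw [hp]
      exact Set.mem_singleton p
    exact this
  choose v hv using H
  refine ⟨⟨v, fun f x => ?_, fun r => isEmptyElim r⟩, hv⟩
  obtain ⟨φ, h1, h2⟩ := ((hv (Structure.funMap f x)).and
    (Filter.eventually_all.2 fun i => hv (x i))).exists
  rw [← h1, φ.map_fun]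
  exact congrArg _ (funext h2)

/-! ### Jónsson-style separation of points -/

section Separation

variable {C E : Type*} [lang.Structure C] [lang.Structure E]

/-- A form of Jónsson's lemma: the kernel of `h` and that of some ultralimit `v` of homomorphisms
into the chain generate a congruence not relating `a` and `b`. -/
theorem exists_hom_chain (hC : ChainSeparated C) (h : C →[lang] E) {a b : C} (hab : h a ≠ h b) :
    ∃ v : C →[lang] Chain, ∀ g, v g = 7 → h (op2 .inf a g) ≠ h (op2 .inf b g) := by
  let Bad : Set (C →[lang] Chain) → Prop := fun S =>
    ∃ g, (∀ φ ∈ S, φ g = 7) ∧ h (op2 .inf a g) = h (op2 .inf b g)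
  -- Identities of `Chain` transfer to `C`, whose points are separated by maps into `Chain`.
  have hbot : ∀ x : C, op2 .inf x (op0 .bot) = op0 .bot := fun x => hC _ _ fun φ => by
    simp only [map_op2, map_op0, chain_inf, chain_bot]
    generalize φ x = p
    decide +revert
  have hdist : ∀ x y z : C, op2 .inf x (op2 .sup y z) = op2 .sup (op2 .inf x y) (op2 .inf x z) :=
    fun x y z => hC _ _ fun φ => by
      simp only [map_op2, chain_inf, chain_sup]
      exact inf_sup_left _ _ _
  -- Bad sets form an ideal, with unions handled by the join of the two witnesses and
  -- distributivity. `F` is the dual filter.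
  let F : Filter (C →[lang] Chain) :=
    { sets := {S | Bad Sᶜ}
      univ_sets := ⟨op0 .bot, by simp, by rw [hbot, hbot]⟩
      sets_of_superset := by
        rintro S T ⟨g, hg, hg'⟩ hST
        exact ⟨g, fun φ hφ => hg φ fun h' => hφ (hST h'), hg'⟩
      inter_sets := by
        rintro S T ⟨g, hg, hg'⟩ ⟨k, hk, hk'⟩
        refine ⟨op2 .sup g k, fun φ hφ => ?_, ?_⟩
        · rw [map_op2, chain_sup]
          by_cases hS : φ ∈ S
          · rw [hk φ fun hT => hφ ⟨hS, hT⟩]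
            exact max_eq_right (Fin.le_last _)
          · rw [hg φ hS]
            exact max_eq_left (Fin.le_last _)
        · rw [hdist, hdist, map_op2 h .sup, hg', hk', ← map_op2] }
  -- If the set of all homomorphisms were bad, its witness `g` would act as the top element, giving
  -- `h a = h b`.
  have hF : F.NeBot := by
    refine ⟨fun hF => hab ?_⟩
    have h0 : (∅ : Set (C →[lang] Chain)) ∈ F := hF ▸ Filter.mem_bot
    obtain ⟨g, hg, hg'⟩ : Bad ∅ᶜ := h0
    have hg1 : ∀ x : C, op2 .inf x g = x := fun x => hC _ _ fun φ => by
      rw [map_op2, hg φ (by simp), chain_inf]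
      exact min_eq_left (Fin.le_last _)
    rwa [hg1, hg1] at hg'
  obtain ⟨v, hv⟩ := exists_ultralimit (Ultrafilter.of F)
  refine ⟨v, fun g hg hg' => ?_⟩
  have h1 : {φ : C →[lang] Chain | φ g = 7}ᶜ ∈ F :=
    ⟨g, fun φ hφ => not_not.1 hφ, hg'⟩
  obtain ⟨φ, h2, h3⟩ := ((hv g).and (Ultrafilter.of_le F h1)).exists
  exact h3 (h2.trans hg)

/-- The points of a homomorphic image of `C` are separated by homomorphisms into the chain and into
the quotient of its subalgebra. -/
theorem exists_separating (hC : ChainSeparated C) (h : C →[lang] E)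
    (hs : Function.Surjective h) {a b : C} (hab : h a ≠ h b) :
    (∃ g : E →[lang] Chain, g (h a) ≠ g (h b)) ∨ ∃ g : E →[lang] Fin 6, g (h a) ≠ g (h b) := by
  obtain ⟨v, hv⟩ := exists_hom_chain hC h hab
  have hinf : ∀ p : Chain, min p 7 = p := fun p => min_eq_left (Fin.le_last _)
  -- `R` is the join of the kernels of `h` and `v`: it is an equivalence containing both, and `x`,
  -- `x ∧ g` have the same image under `v` when `v g = 7`.
  let R : C → C → Prop := fun x y => ∃ g, v g = 7 ∧ h (op2 .inf x g) = h (op2 .inf y g)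
  have hRab : ¬ R a b := fun ⟨g, hg, hg'⟩ => hv g hg hg'
  have hR_of_v : ∀ x y, v x = v y → R x y := by
    intro x y hxy
    refine ⟨equivOp x y, by rw [map_equivOp, chain_equivOp, if_pos hxy], congrArg h ?_⟩
    refine hC _ _ fun φ => ?_
    simp only [map_op2, map_equivOp, chain_inf, chain_equivOp]
    generalize φ x = p
    generalize φ y = q
    decide +revert
  have hR_of_h : ∀ x y, h x = h y → R x y := by
    intro x y hxy
    refine ⟨op0 .top, map_op0 v _, ?_⟩
    rw [map_op2, map_op2, hxy]
  have hR_symm : ∀ x y, R x y → R y x := fun x y ⟨g, hg, hg'⟩ => ⟨g, hg, hg'.symm⟩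
  have hR_trans : ∀ x y z, R x y → R y z → R x z := by
    rintro x y z ⟨g, hg, hg'⟩ ⟨k, hk, hk'⟩
    refine ⟨op2 .inf g k, by rw [map_op2, hg, hk]; rfl, ?_⟩
    have h1 : ∀ x : C, op2 .inf x (op2 .inf g k) = op2 .inf (op2 .inf x g) k := fun x =>
      hC _ _ fun φ => by
        simp only [map_op2, chain_inf]
        exact (min_assoc _ _ _).symm
    have h2 : ∀ x : C, op2 .inf (op2 .inf x g) k = op2 .inf (op2 .inf x k) g := fun x =>
      hC _ _ fun φ => by
        simp only [map_op2, chain_inf]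
        exact min_right_comm _ _ _
    rw [h1, h1, map_op2, hg', ← map_op2, h2, map_op2, hk', ← map_op2, h2]
  -- Otherwise `R` would collapse 0 and 1: the witness k₁ ∧ ¬k₂ has `v`-value 1, but its meet with
  -- any element is sent by `h` to 0.
  have hno : ∀ k₁ k₂, h k₁ = h k₂ → v k₁ = 7 → v k₂ ≠ 0 := by
    intro k₁ k₂ hk h1 h2
    refine hRab ⟨op2 .inf k₁ (op2 .imp k₂ (op0 .bot)), ?_, ?_⟩
    · simp only [map_op2, map_op0, h1, h2]
      rfl
    · have h3 : ∀ x : C,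
          h (op2 .inf x (op2 .inf k₁ (op2 .imp k₂ (op0 .bot)))) = h (op0 .bot) := by
        intro x
        rw [map_op2, map_op2, hk, ← map_op2, ← map_op2]
        refine congrArg h (hC _ _ fun φ => ?_)
        simp only [map_op2, map_op0, chain_inf, chain_imp, chain_bot]
        generalize φ x = p
        generalize φ k₂ = q
        decide +revert
      rw [h3, h3]
  -- If `R` relates `x` and `y`, it collapses (x ↔ y) ∨ d with 1. The parameter `d` raises the
  -- collapsed element to a prescribed value.
  have hjoin : ∀ x y d, R x y → ∃ s g, v g = 7 ∧ h s = h g ∧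
      v s = max (equivOp (v x) (v y)) (v d) := by
    rintro x y d ⟨g, hg, hg'⟩
    refine ⟨op2 .inf (op2 .sup (equivOp x y) d) g, g, hg, ?_, ?_⟩
    · have h1 : op2 .inf (op2 .sup (equivOp x y) d) g =
          op2 .inf (op2 .sup (equivOp (op2 .inf x g) (op2 .inf y g)) d) g := by
        refine hC _ _ fun φ => ?_
        simp only [map_op2, map_equivOp, chain_inf, chain_sup, chain_equivOp]
        generalize φ x = p
        generalize φ y = q
        generalize φ g = r
        rw [inf_sup_right, inf_sup_right]
        congr 1
        clear * -
        decide +revert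
      have h2 : op2 .inf (op2 .sup (equivOp (op2 .inf y g) (op2 .inf y g)) d) g = g := by
        refine hC _ _ fun φ => ?_
        simp only [map_op2, map_equivOp, chain_inf, chain_sup, chain_equivOp, if_true]
        generalize φ d = q
        generalize φ g = r
        clear * -
        decide +revert
      rw [h1, map_op2, map_op2, map_equivOp, hg', ← map_equivOp, ← map_op2, ← map_op2, h2]
    · simp only [map_op2, map_equivOp, chain_inf, chain_sup, hg, hinf]
  by_cases hRv : ∀ x y, R x y → v x = v y
  · left
    obtain ⟨g, hg⟩ := exists_factor h hs v fun x y hxy => hRv x y (hR_of_h x y hxy)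
    refine ⟨g, ?_⟩
    rw [hg, hg]
    exact fun h' => hRab (hR_of_v a b h')
  right
  push Not at hRv
  obtain ⟨x₀, y₀, hxy₀, hne₀⟩ := hRv
  have hv4 : ∀ c, v c ≠ 4 := by
    intro c hc
    -- The term 0 + 1 names a₆. Once a₆ is collapsed with 1, the values a₄ ∗ a₆ = 1 and a₄ ∗ 1 = 0
    -- contradict `hno`.
    let d : C := op2 .add (op0 .bot) (op0 .top)
    have hd : v d = 6 := by
      simp only [d, map_op2, map_op0]
      rfl
    obtain ⟨s, g, hg, hsg, hvs⟩ := hjoin x₀ y₀ d hxy₀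
    refine hno (op2 .star c s) (op2 .star c g) (by rw [map_op2, map_op2, hsg]) ?_ ?_
    · rw [map_op2, hvs, hc, hd, chain_equivOp, chain_star]
      generalize v x₀ = p at *
      generalize v y₀ = q at *
      clear * - hne₀
      decide +revert
    · rw [map_op2, hc, hg]
      rfl
  have hRquot : ∀ x y, R x y → quotMap (v x) = quotMap (v y) := by
    intro x y hxy
    by_contra hne
    -- Collapsing anything beyond {a₆, 1} would collapse a₅ with 1, against □a₅ = 1 and □1 = 0.
    obtain ⟨s, g, hg, hsg, hvs⟩ := hjoin x y (op0 .a5) hxy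
    refine hno (op1 .box s) (op1 .box g) (by rw [map_op1, map_op1, hsg]) ?_ ?_
    · have hx := hv4 x
      have hy := hv4 y
      rw [map_op1, hvs, map_op0, chain_a5, chain_equivOp, chain_box]
      generalize v x = p at *
      generalize v y = q at *
      clear * - hne hx hy
      decide +revert
    · rw [map_op1, hg]
      rfl
  have hquot : ∀ p q : Chain, p ≠ 4 → q ≠ 4 → p ≠ q → quotMap p = quotMap q →
      p = 6 ∧ q = 7 ∨ p = 7 ∧ q = 6 := by
    decide
  obtain ⟨x₁, y₁, hxy₁, hx₁, hy₁⟩ : ∃ x y, R x y ∧ v x = 6 ∧ v y = 7 := by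
    rcases hquot _ _ (hv4 x₀) (hv4 y₀) hne₀ (hRquot _ _ hxy₀) with ⟨h1, h2⟩ | ⟨h1, h2⟩
    · exact ⟨x₀, y₀, hxy₀, h1, h2⟩
    · exact ⟨y₀, x₀, hR_symm _ _ hxy₀, h2, h1⟩
  have hR_of_quot : ∀ x y, quotMap (v x) = quotMap (v y) → R x y := by
    intro x y hxy
    by_cases hvxy : v x = v y
    · exact hR_of_v x y hvxy
    rcases hquot _ _ (hv4 x) (hv4 y) hvxy hxy with ⟨h1, h2⟩ | ⟨h1, h2⟩
    · exact hR_trans _ _ _ (hR_of_v x x₁ (h1.trans hx₁.symm))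
        (hR_trans _ _ _ hxy₁ (hR_of_v y₁ y (hy₁.trans h2.symm)))
    · exact hR_trans _ _ _ (hR_of_v x y₁ (h1.trans hy₁.symm))
        (hR_trans _ _ _ (hR_symm _ _ hxy₁) (hR_of_v x₁ y (hx₁.trans h2.symm)))
  let w : C →[lang] Fin 6 :=
    { toFun := fun x => quotMap (v x)
      map_fun' := fun f x => by
        rw [v.map_fun]
        exact quotMap_funMap f _ fun i => hv4 (x i)
      map_rel' := fun r => isEmptyElim r }
  obtain ⟨g, hg⟩ := exists_factor h hs w fun x y hxy => hRquot x y (hR_of_h x y hxy)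
  refine ⟨g, ?_⟩
  rw [hg, hg]
  exact fun h' => hRab (hR_of_quot a b h')

end Separation

/-! ## Varieties -/

section Algebras

variable {L : FirstOrder.Language.{v, w}}

theorem isVariety_varietyOf (A : Alg.{u} L) : IsVariety (varietyOf A) :=
  ⟨fun C hC B h hs K hK hA => hK.1 C (hC K hK hA) B h hs,
    fun C hC B e K hK hA => hK.2.1 C (hC K hK hA) B e,
    fun I C hC K hK hA => hK.2.2 I C fun i => hC i K hK hA⟩

theorem mem_varietyOf_self (A : Alg.{u} L) : A ∈ varietyOf A := fun _ _ hA => hA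

theorem ClosedUnderS.closedUnderI {K : Set (Alg.{u} L)} (hK : ClosedUnderS K) :
    ClosedUnderI K :=
  fun A hA B ⟨e⟩ => hK A hA B ⟨e.symm.toEmbedding⟩

/-- A copy in `Type u` of a structure with carrier in `Type`. -/
def liftAlg (L : FirstOrder.Language.{v, w}) (M : Type) [L.Structure M] : Alg.{u} L :=
  Equiv.ulift.{u}.symm.bundledInduced (M := M) L

/-- The isomorphism between a structure and its copy. -/
def liftEquiv (M : Type) [L.Structure M] : M ≃[L] liftAlg.{u} L M :=
  Equiv.bundledInducedEquiv L _

/-- The projections of a direct product. -/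
def piProj [∀ n, IsEmpty (L.Relations n)] {I : Type u} (A : I → Alg.{u} L) (i : I) :
    piAlg A →[L] A i where
  toFun x := x i
  map_fun' _ _ := rfl
  map_rel' r := isEmptyElim r

/-- The homomorphism into a direct product with given components. -/
def piLift [∀ n, IsEmpty (L.Relations n)] {I : Type u} {A : I → Alg.{u} L} {C : Type*}
    [L.Structure C] (h : ∀ i, C →[L] A i) : C →[L] piAlg A where
  toFun x := fun i => h i x
  map_fun' f x := funext fun i => (h i).map_fun f x
  map_rel' r := isEmptyElim r

/-- An injective homomorphism between algebras, as an embedding. -/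
def embOfInjective [∀ n, IsEmpty (L.Relations n)] {C D : Type*} [L.Structure C]
    [L.Structure D] (h : C →[L] D) (hi : Function.Injective h) : C ↪[L] D where
  toFun := h
  inj' := hi
  map_fun' f x := h.map_fun f x
  map_rel' r := isEmptyElim r

end Algebras

/-! ### Members of the generated variety -/

/-- The homomorphic images of the algebras whose points are separated by homomorphisms into
`Chain`. -/
def chainImages : Set (Alg.{u} lang) :=
  {E | ∃ (C : Alg.{u} lang) (h : C →[lang] E), Function.Surjective h ∧ ChainSeparated C}

theorem isVariety_chainImages : IsVariety chainImages.{u} := by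
  refine ⟨?_, ?_, ?_⟩
  · rintro E ⟨C, h, hs, hC⟩ B k hk
    exact ⟨C, k.comp h, hk.comp hs, hC⟩
  · rintro E ⟨C, h, hs, hC⟩ B ⟨e⟩
    -- A subalgebra of an image of `C` is the image of its preimage in `C`.
    let S : lang.Substructure C := e.toHom.range.comap h
    have hS : ∀ x : S, ∃ y : B, e y = h x := fun x => x.2
    choose k hk using hS
    refine ⟨⟨S, inferInstance⟩, ⟨k, fun f x => e.injective ?_, fun r => isEmptyElim r⟩, ?_, ?_⟩
    · rw [hk, e.map_fun]
      refine (h.map_fun f fun i => (x i : C)).trans (congrArg _ ?_)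
      exact funext fun i => (hk (x i)).symm
    · intro y
      obtain ⟨c, hc⟩ := hs (e y)
      exact ⟨⟨c, y, hc.symm⟩, e.injective ((hk _).trans hc)⟩
    · intro x y hxy
      exact Subtype.ext (hC _ _ fun φ => hxy (φ.comp S.subtype.toHom))
  · intro I E hE
    choose C h hs hC using hE
    refine ⟨piAlg C, piLift fun i => (h i).comp (piProj C i), fun y => ?_, fun x y hxy => ?_⟩
    · choose x hx using fun i => hs i (y i)
      exact ⟨x, funext hx⟩
    · exact funext fun i => hC i _ _ fun φ => hxy (φ.comp (piProj C i))

/-- The points of a member of `𝕍(A)` are separated by homomorphisms into `Chain` and into the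
quotient of its subalgebra. -/
theorem exists_separating_of_mem {E : Alg.{u} lang} (hE : E ∈ varietyOf A8.{u}) {a b : E}
    (hab : a ≠ b) :
    (∃ g : E →[lang] Chain, g a ≠ g b) ∨ ∃ g : E →[lang] Fin 6, g a ≠ g b := by
  have hA : A8.{u} ∈ chainImages.{u} :=
    ⟨A8, Hom.id lang A8, Function.surjective_id, fun x y hxy =>
      (liftEquiv.{u} (L := lang) Chain).symm.injective
        (hxy (liftEquiv.{u} (L := lang) Chain).symm.toHom)⟩
  obtain ⟨C, h, hs, hC⟩ := hE _ isVariety_chainImages hA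
  obtain ⟨x, rfl⟩ := hs a
  obtain ⟨y, rfl⟩ := hs b
  exact exists_separating hC h hs hab

theorem lift_sub_mem : liftAlg.{u} lang (Fin 7) ∈ varietyOf A8.{u} :=
  (isVariety_varietyOf _).2.1 _ (mem_varietyOf_self _) _
    ⟨((liftEquiv.{u} (L := lang) Chain).toEmbedding.comp subEmb).comp
      (liftEquiv.{u} (L := lang) (Fin 7)).symm.toEmbedding⟩

theorem lift_quot_mem : liftAlg.{u} lang (Fin 6) ∈ varietyOf A8.{u} :=
  (isVariety_varietyOf _).1 _ lift_sub_mem _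
    (((liftEquiv.{u} (L := lang) (Fin 6)).toHom.comp quotHom).comp
      (liftEquiv.{u} (L := lang) (Fin 7)).symm.toHom)
    ((liftEquiv.{u} (L := lang) (Fin 6)).surjective.comp
      (quotHom_surjective.comp (liftEquiv.{u} (L := lang) (Fin 7)).symm.surjective))

/-! ## The implicit operation -/

/-- Homomorphisms preserve the graph, and it is functional in the two algebras whose homomorphisms
separate points. -/
theorem Graph.unique {E : Alg.{u} lang} (hE : E ∈ varietyOf A8.{u}) {x y z : E}
    (hy : Graph x y) (hz : Graph x z) : y = z := by
  by_contra hne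
  rcases exists_separating_of_mem hE hne with ⟨g, hg⟩ | ⟨g, hg⟩
  · exact hg (((graph_chain _ _).1 (hy.map g)).trans ((graph_chain _ _).1 (hz.map g)).symm)
  · exact hg (((graph_quot _ _).1 (hy.map g)).trans ((graph_quot _ _).1 (hz.map g)).symm)

/-- The implicit operation defined by `phi`. -/
noncomputable def phiOp : PartialFunctionOn (varietyOf A8.{u}) 1 :=
  fun _ a => ⟨∃ b, Graph (a 0) b, fun h => h.choose⟩

theorem mem_phiOp (A : varietyOf A8.{u}) (a : Fin 1 → A.1) (b : A.1) :
    b ∈ phiOp A a ↔ Graph (a 0) b :=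
  ⟨fun ⟨h, hb⟩ => hb ▸ h.choose_spec, fun h => ⟨⟨b, h⟩, Graph.unique A.2 (Exists.choose_spec _) h⟩⟩

theorem definedBy_phiOp : DefinedBy phiOp.{u} phi := by
  refine ⟨⟨le_rfl, fun A hA a b c hb hc => ?_⟩, fun A a b => ?_⟩
  · rw [sat_phi_iff] at hb hc
    exact hb.unique hA hc
  · rw [sat_phi_iff, mem_phiOp]

theorem isPP_phi : IsPP phi := .ex (.conj (.equal _ _))

theorem isOperation_phiOp : IsOperation phiOp.{u} := by
  intro A B h a b hb
  rw [mem_phiOp] at hb ⊢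
  exact hb.map h

theorem exists_graph_pi {I : Type u} (D : I → Alg.{u} lang)
    (hD : ∀ i, ∀ x : D i, ∃ y, Graph x y) (x : piAlg D) : ∃ y, Graph x y := by
  choose y z hz using fun i => hD i (x i)
  refine ⟨y, z, funext fun i => ?_⟩
  exact (map_op2 (piProj D i) .add x y).trans ((hz i).trans (map_op1 (piProj D i) .dia z).symm)

theorem isExtendable_phiOp : IsExtendable phiOp.{u} := by
  intro A
  -- One factor for each homomorphism into `Chain` or its subquotient; the evaluation map into the
  -- product is then injective.
  let D : (A.1 →[lang] Chain) ⊕ (A.1 →[lang] Fin 6) → Alg.{u} lang :=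
    Sum.elim (fun _ => liftAlg lang Chain) (fun _ => liftAlg lang (Fin 6))
  let k : ∀ i, A.1 →[lang] D i := fun i => match i with
    | .inl g => (liftEquiv.{u} (L := lang) Chain).toHom.comp g
    | .inr g => (liftEquiv.{u} (L := lang) (Fin 6)).toHom.comp g
  have hD : ∀ i, D i ∈ varietyOf A8.{u} := by
    rintro (g | g)
    · exact mem_varietyOf_self _
    · exact lift_quot_mem
  refine ⟨⟨piAlg D, (isVariety_varietyOf _).2.2 _ D hD⟩,
    ⟨embOfInjective (piLift k) fun a b hab => ?_⟩, fun a => ?_⟩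
  · by_contra hne
    rcases exists_separating_of_mem A.2 hne with ⟨g, hg⟩ | ⟨g, hg⟩
    · exact hg ((liftEquiv.{u} (L := lang) Chain).injective (congrFun hab (.inl g)))
    · exact hg ((liftEquiv.{u} (L := lang) (Fin 6)).injective (congrFun hab (.inr g)))
  · refine exists_graph_pi D ?_ (a 0)
    rintro (g | g) x
    · obtain ⟨x, rfl⟩ := (liftEquiv.{u} (L := lang) Chain).surjective x
      exact ⟨_, ((graph_chain x _).2 rfl).map (liftEquiv.{u} (L := lang) Chain).toHom⟩
    · obtain ⟨x, rfl⟩ := (liftEquiv.{u} (L := lang) (Fin 6)).surjective x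
      exact ⟨_, ((graph_quot x _).2 rfl).map (liftEquiv.{u} (L := lang) (Fin 6)).toHom⟩

theorem phiOp_mem : phiOp.{u} ∈ extPP (varietyOf A8.{u}) 1 :=
  ⟨⟨⟨phi, definedBy_phiOp⟩, isOperation_phiOp⟩, isExtendable_phiOp, phi, isPP_phi,
    definedBy_phiOp⟩

/-! ## The pp expansion -/

/-- The family consisting of the operation defined by `phi`. -/
noncomputable def phiFamily : ExtPPFamily (varietyOf A8.{u}) := .single phiOp phiOp_mem

/-- The language of the pp expansion. -/
noncomputable abbrev phiLang : FirstOrder.Language := phiFamily.{u}.expandedLanguage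

instance isEmpty_phiLang_relations (n : ℕ) : IsEmpty (phiLang.{u}.Relations n) :=
  inferInstanceAs (IsEmpty (Empty ⊕ Empty))

/-- The symbol added to the language. -/
noncomputable def newSymb : phiLang.{u}.Functions 1 := phiFamily.{u}.symbol ()

/-- The operation denoted by the new symbol. -/
noncomputable def newOp {M : Type*} [phiLang.{u}.Structure M] (x : M) : M :=
  Structure.funMap newSymb.{u} ![x]

theorem map_newOp {M N : Type*} [phiLang.{u}.Structure M] [phiLang.{u}.Structure N]
    (h : M →[phiLang.{u}] N) (x : M) : h (newOp x) = newOp (h x) :=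
  (h.map_fun newSymb ![x]).trans
    (congrArg (Structure.funMap newSymb.{u}) (by funext i; fin_cases i; rfl))

/-- A homomorphism between algebras of the expanded language is one between their reducts. -/
noncomputable def reductHom {B D : Alg.{u} phiLang.{u}} (h : B →[phiLang.{u}] D) :
    phiFamily.reduct B →[lang] phiFamily.reduct D where
  toFun := h
  map_fun' f x := h.map_fun (Sum.inl f : phiLang.{u}.Functions _) x
  map_rel' r := isEmptyElim r

theorem mem_expandedClass_iff (B : Alg.{u} phiLang.{u}) :
    B ∈ phiFamily.expandedClass ↔ phiFamily.reduct B ∈ varietyOf A8.{u} ∧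
      ∀ x : B, Graph (M := phiFamily.reduct B) x (newOp (M := B) x) := by
  have key : ∀ hB : phiFamily.reduct B ∈ varietyOf A8.{u}, ∀ a : Fin 1 → B,
      (Structure.funMap newSymb.{u} a : B) ∈ phiOp ⟨phiFamily.reduct B, hB⟩ a ↔
        Graph (M := phiFamily.reduct B) (a 0) (newOp (M := B) (a 0)) := by
    intro hB a
    have ha : a = ![a 0] := by
      funext i
      fin_cases i
      rfl
    have h1 : Structure.funMap newSymb.{u} a = newOp (a 0) := congrArg _ ha
    rw [h1]
    exact mem_phiOp ⟨phiFamily.reduct B, hB⟩ a (newOp (M := B) (a 0))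
  constructor
  · rintro ⟨hB, h⟩
    exact ⟨hB, fun x => (key hB ![x]).1 (h () ![x])⟩
  · rintro ⟨hB, h⟩
    exact ⟨hB, fun _ a => (key hB a).2 (h _)⟩

/-- A pp formula satisfied by an element and its new value survives under homomorphisms, and
surjectivity covers every argument. -/
theorem closedUnderH_expandedClass : ClosedUnderH phiFamily.{u}.expandedClass := by
  intro B hB D h hs
  rw [mem_expandedClass_iff] at hB ⊢
  refine ⟨(isVariety_varietyOf _).1 _ hB.1 _ (reductHom h) hs, fun y => ?_⟩
  obtain ⟨x, rfl⟩ := hs y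
  rw [← map_newOp]
  exact (hB.2 x).map (reductHom h)

theorem closedUnderP_expandedClass : ClosedUnderP phiFamily.{u}.expandedClass := by
  intro I D hD
  simp only [mem_expandedClass_iff] at hD ⊢
  refine ⟨(isVariety_varietyOf A8.{u}).2.2 I (fun i => phiFamily.reduct (D i))
    fun i => (hD i).1, fun x => ?_⟩
  choose z hz using fun i => (hD i).2 (x i)
  refine ⟨z, funext fun i => ?_⟩
  have h1 := map_op2 (reductHom (piProj D i)) .add x (newOp (M := piAlg D) x)
  have h2 := map_op1 (reductHom (piProj D i)) .dia z
  have h3 := map_newOp (piProj D i) x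
  refine h1.trans (Eq.trans ?_ ((hz i).trans h2.symm))
  exact congrArg (op2 (M := phiFamily.reduct (D i)) .add (x i)) h3

/-- An ultraproduct is a homomorphic image of the direct product. -/
theorem closedUnderPu_expandedClass : ClosedUnderPu phiFamily.{u}.expandedClass := by
  intro I U D hD
  refine closedUnderH_expandedClass _ (closedUnderP_expandedClass I D hD) _
    ⟨Quotient.mk ((U : Filter I).productSetoid fun i => D i), fun f x => ?_,
      fun r => isEmptyElim r⟩ Quotient.mk_surjective
  exact (Ultraproduct.funMap_cast f x).symm

theorem isQuasivariety_ppExpansion : IsQuasivariety phiFamily.{u}.ppExpansion := by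
  have hS : ClosedUnderS phiFamily.{u}.ppExpansion := fun A ⟨D, hD, ⟨e⟩⟩ B ⟨e'⟩ =>
    ⟨D, hD, ⟨e.comp e'⟩⟩
  refine ⟨hS.closedUnderI, hS, ?_, ?_⟩
  · intro I A hA
    choose D hD e using hA
    refine ⟨piAlg D, closedUnderP_expandedClass I D hD,
      ⟨embOfInjective (piLift fun i => (e i).some.toHom.comp (piProj A i)) ?_⟩⟩
    intro x y hxy
    exact funext fun i => (e i).some.injective (congrFun hxy i)
  · intro I U A hA
    choose D hD e using hA
    refine ⟨ultraAlg U D, closedUnderPu_expandedClass I U D hD,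
      ⟨embOfInjective ⟨Quotient.map' (s₁ := (U : Filter I).productSetoid fun i => A i)
        (s₂ := (U : Filter I).productSetoid fun i => D i) (fun x i => (e i).some (x i)) ?_,
        fun f x => ?_, fun r => isEmptyElim r⟩ ?_⟩⟩
    · intro x y hxy
      exact Filter.Eventually.mono hxy fun i hi => congrArg _ hi
    · choose y hy using fun i => Quotient.mk_surjective (x i)
      obtain rfl : x = fun i => Quotient.mk _ (y i) := funext fun i => (hy i).symm
      have h1 := Ultraproduct.funMap_cast (u := U) f y
      refine (congrArg _ h1).trans (Eq.trans ?_
        (Ultraproduct.funMap_cast (u := U) f fun j i => (e i).some (y j i)).symm)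
      exact congrArg (Quotient.mk _) (funext fun i => (e i).some.map_fun f fun j => y j i)
    · intro x y
      refine Quotient.inductionOn₂ x y fun x y hxy => ?_
      exact Quotient.sound (Filter.Eventually.mono (Quotient.exact hxy)
        fun i hi => (e i).some.injective hi)

/-! ## A quotient outside of the pp expansion -/

/-- The expansion of an algebra by a unary operation. -/
@[reducible]
def expansion (M : Type*) [lang.Structure M] (g : M → M) : phiLang.{u}.Structure M where
  funMap f x := match f with
    | .inl f => Structure.funMap (L := lang) f x
    -- The arity of a new symbol is 1 only up to the propositional equality `f.2`, hence the
    -- explicit index.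
    | .inr f => g (x ⟨0, Nat.lt_of_lt_of_eq Nat.one_pos f.2⟩)
  RelMap r := isEmptyElim r

noncomputable instance chainExpansion : phiLang.{u}.Structure Chain := expansion Chain chainFun

/-- The operation on the subalgebra obtained by restricting `chainFun`. -/
def subFun (x : Fin 7) : Fin 7 := if x = 0 then 3 else 1

theorem subIncl_subFun (x : Fin 7) : subIncl (subFun x) = chainFun (subIncl x) := by
  unfold subFun chainFun
  decide +revert

noncomputable instance subExpansion : phiLang.{u}.Structure (Fin 7) := expansion (Fin 7) subFun

/-- The inclusion of `Chain \ {a₄}` as an embedding of expansions. -/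
noncomputable def expandedSubEmb : Fin 7 ↪[phiLang.{u}] Chain :=
  embOfInjective
    { toFun := subEmb
      map_fun' := fun f x => match f with
        | .inl f => subEmb.map_fun f x
        | .inr _ => subIncl_subFun _
      map_rel' := fun r => isEmptyElim r } subEmb.injective

theorem lift_chain_mem : liftAlg.{u} phiLang.{u} Chain ∈ phiFamily.expandedClass := by
  rw [mem_expandedClass_iff]
  let e : Chain →[lang] phiFamily.reduct (liftAlg.{u} phiLang.{u} Chain) :=
    { toFun := liftEquiv.{u} (L := phiLang.{u}) Chain
      map_fun' := fun f x =>
        (liftEquiv.{u} (L := phiLang.{u}) Chain).map_fun (Sum.inl f : phiLang.{u}.Functions _) x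
      map_rel' := fun r => isEmptyElim r }
  have he : Function.Surjective e := (liftEquiv.{u} (L := phiLang.{u}) Chain).surjective
  refine ⟨(isVariety_varietyOf _).1 _ (mem_varietyOf_self _) _
    (e.comp (liftEquiv.{u} (L := lang) Chain).symm.toHom)
    (he.comp (liftEquiv.{u} (L := lang) Chain).symm.surjective), fun x => ?_⟩
  obtain ⟨x, rfl⟩ := (liftEquiv.{u} (L := phiLang.{u}) Chain).surjective x
  have h1 := map_newOp (liftEquiv.{u} (L := phiLang.{u}) Chain).toHom x
  have h2 := ((graph_chain x (chainFun x)).2 rfl).map e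
  exact (congrArg (Graph (M := phiFamily.reduct (liftAlg.{u} phiLang.{u} Chain)) (e x)) h1).mp h2

/-- The expansion of the subalgebra, as an algebra with carrier in `Type u`. -/
noncomputable def subAlg : Alg.{u} phiLang.{u} := liftAlg phiLang.{u} (Fin 7)

theorem subAlg_mem : subAlg.{u} ∈ phiFamily.{u}.ppExpansion :=
  ⟨_, lift_chain_mem, ⟨((liftEquiv.{u} (L := phiLang.{u}) Chain).toEmbedding.comp
    expandedSubEmb).comp (liftEquiv.{u} (L := phiLang.{u}) (Fin 7)).symm.toEmbedding⟩⟩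

theorem reduct_subAlg_mem : phiFamily.reduct subAlg.{u} ∈ varietyOf A8.{u} := by
  obtain ⟨D, hD, ⟨e⟩⟩ := subAlg_mem.{u}
  exact (isVariety_varietyOf _).2.1 _ ((mem_expandedClass_iff D).1 hD).1 _
    ⟨embOfInjective (reductHom e.toHom) e.injective⟩

/-- The congruence of the subalgebra identifying `a₆` and `1`. -/
def topSetoid : Setoid subAlg.{u} := Setoid.ker fun x : ULift.{u} (Fin 7) => quotHom x.down

theorem isCongruence_topSetoid : IsCongruence subAlg.{u} topSetoid := by
  intro n f x y hxy
  have hxy' : (fun i => quotHom (x i).down) = fun i => quotHom (y i).down := funext hxy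
  rcases f with f | f
  · have h1 := quotHom.map_fun f fun i => (x i).down
    have h2 := quotHom.map_fun f fun i => (y i).down
    exact h1.trans ((congrArg (Structure.funMap f) hxy').trans h2.symm)
  -- The new operation only tests whether its argument is 0, so it respects the identification of a₆
  -- with 1.
  · have key : ∀ p q : Fin 7, quotHom p = quotHom q → subFun p = subFun q := by
      change ∀ p q : Fin 7, quotMap (subIncl p) = quotMap (subIncl q) → subFun p = subFun q
      unfold subFun
      decide
    exact congrArg quotHom (key _ _ (hxy ⟨0, Nat.lt_of_lt_of_eq Nat.one_pos f.2⟩))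

/-- The quotient map of an algebra by a congruence. -/
def quotientHom {L : FirstOrder.Language.{v, w}} [∀ n, IsEmpty (L.Relations n)] (A : Alg.{u} L)
    (θ : Setoid A) (hθ : IsCongruence A θ) : A →[L] quotientAlg A θ where
  toFun := Quotient.mk θ
  map_fun' f x := (quotientAlg_funMap_mk A θ hθ f x).symm
  map_rel' r := isEmptyElim r

theorem quotient_notMem : quotientAlg subAlg.{u} topSetoid ∉ phiFamily.{u}.ppExpansion := by
  rintro ⟨D, hD, ⟨e⟩⟩
  rw [mem_expandedClass_iff] at hD
  let q := quotientHom subAlg.{u} topSetoid isCongruence_topSetoid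
  let j : subAlg.{u} →[phiLang.{u}] D := e.toHom.comp q
  let k : Fin 7 →[phiLang.{u}] D := j.comp (liftEquiv.{u} (L := phiLang.{u}) (Fin 7)).toHom
  let k' : Fin 7 →[lang] phiFamily.reduct D :=
    { toFun := k
      map_fun' := fun f x => k.map_fun (Sum.inl f : phiLang.{u}.Functions _) x
      map_rel' := fun r => isEmptyElim r }
  -- In `Fin 7` the numerals 3, 5, 6 stand for a₃, a₆, 1.
  have h67 : k 5 = k 6 := congrArg e (Quotient.sound (s := topSetoid) rfl)
  have h1 : Graph (k' 0) (k' 3) := by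
    have h := hD.2 (k 0)
    rw [← map_newOp k] at h
    exact h
  have h2 : Graph (k' 0) (k' 6) := by
    -- The witness is 0: in the subalgebra 0 + 1 = a₆ and ◇0 = 1, which `k` identifies.
    refine ⟨k' 0, ?_⟩
    rw [← map_op2, ← map_op1]
    exact h67
  have h3 : q (ULift.up 3) = q (ULift.up 6) := e.injective (h1.unique hD.1 h2)
  have h4 : quotHom 3 = quotHom 6 := Quotient.exact h3
  exact absurd h4 (by change quotMap (subIncl 3) ≠ quotMap (subIncl 6); decide)

theorem not_closedUnderH_ppExpansion : ¬ ClosedUnderH phiFamily.{u}.ppExpansion := fun h =>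
  quotient_notMem (h _ subAlg_mem _ (quotientHom _ _ isCongruence_topSetoid)
    Quotient.mk_surjective)

/-- The same congruence serves again: as a variety, the original class contains the quotient of the
reduct. -/
theorem not_congruencePreserving : ¬ phiFamily.{u}.CongruencePreserving := by
  intro h
  have hc : IsCongruence (phiFamily.reduct subAlg.{u}) topSetoid := fun n f x y hxy =>
    isCongruence_topSetoid n (Sum.inl f) x y hxy
  have hmem : topSetoid ∈ relCon (varietyOf A8.{u}) (phiFamily.reduct subAlg.{u}) :=
    ⟨hc, (isVariety_varietyOf _).1 _ reduct_subAlg_mem _ (quotientHom _ _ hc)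
      Quotient.mk_surjective⟩
  rw [← h _ subAlg_mem] at hmem
  exact quotient_notMem hmem.2

end PPExpansions

theorem theorem2p1 :
    ∃ (f : PPExpansions.PartialFunctionOn (PPExpansions.varietyOf PPExpansions.A8.{u}) 1)
      (hf : f ∈ PPExpansions.extPP (PPExpansions.varietyOf PPExpansions.A8.{u}) 1),
      PPExpansions.DefinedBy f PPExpansions.phi ∧
      PPExpansions.IsProperQuasivariety (PPExpansions.ExtPPFamily.single f hf).ppExpansion ∧
      ¬ PPExpansions.ClosedUnderH (PPExpansions.ExtPPFamily.single f hf).ppExpansion ∧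
      ¬ (PPExpansions.ExtPPFamily.single f hf).CongruencePreserving :=
  ⟨PPExpansions.phiOp, PPExpansions.phiOp_mem, PPExpansions.definedBy_phiOp,
    ⟨PPExpansions.isQuasivariety_ppExpansion,
      fun h => PPExpansions.not_closedUnderH_ppExpansion h.1⟩,
    PPExpansions.not_closedUnderH_ppExpansion, PPExpansions.not_congruencePreserving⟩
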